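/- For sets $A, S \subseteq \mathbb{N}$, say that $S$ computes $A$ if $A$ is Turing reducible to $S$. A set $A \subseteq \mathbb{N}$ is *introcomputable* from an infinite set $B \subseteq \mathbb{N}$ if every infinite subset of $B$ computes $A$, and an infinite set is *introreducible* if it is introcomputable from itself (that is, computable from each of its infinite subsets). **Corollary.** Every infinite set $A \subseteq \mathbb{N}$ has an infinite subset $B$ such that for all infinite sets $C, D \subseteq B$, $C$ is not introcomputable from $D$. In particular, $B$ has no introreducible subset. -/

import Mathlib

/-- The characteristic function of a set of natural numbers, as a (total) element of `ℕ →. ℕ`. -/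
noncomputable def charFun (A : Set ℕ) : ℕ →. ℕ :=
  open Classical in fun n => Part.some (if n ∈ A then 1 else 0)

/-- `S` computes `A`: the set `A` is Turing reducible to the set `S`. -/
def SetComputes (S A : Set ℕ) : Prop :=
  TuringReducible (charFun A) (charFun S)

/-- `A` is introcomputable from the (infinite) set `B`: every infinite subset of `B` computes `A`. -/
def Introcomputable (A B : Set ℕ) : Prop :=
  ∀ S : Set ℕ, S ⊆ B → S.Infinite → SetComputes S A

/-- An infinite set is introreducible if it is introcomputable from itself, that is, if it is
computable from each of its infinite subsets. -/
def Introreducible (A : Set ℕ) : Prop :=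
  A.Infinite ∧ Introcomputable A A

/-! The set `B` is built so that no `S ⊆ B` enumerates a set `C ⊆ B` with `C \ S` infinite. Halting
with output 1 is an open condition on the oracle, and there are countably many codes. Whenever a new
element `x` enters `B`, some smaller `t` is left out forever. The two are chosen so that, for the
codes considered so far, accepting `x` forces accepting `t`, whatever part of `B \ {x}` is the
oracle. If code `e` enumerated `C` from `S`, a large `x ∈ C \ S` would put its `t` into `C ⊆ B`,
which is absurd. Such pairs (`exists_lt_indistinguishable`) come from the Ramsey property of open
sets (`IsOpenProp.exists_homogeneous`) and pigeonhole. -/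

/-- Codes for partial functions that are recursive in a single oracle. -/
inductive OracleCode : Type
  | zero : OracleCode
  | succ : OracleCode
  | left : OracleCode
  | right : OracleCode
  | oracle : OracleCode
  | pair : OracleCode → OracleCode → OracleCode
  | comp : OracleCode → OracleCode → OracleCode
  | prec : OracleCode → OracleCode → OracleCode
  | rfind : OracleCode → OracleCode
  deriving Countable

namespace OracleCode

/-- The partial function computed by a code from the oracle `g`. -/
def eval (g : ℕ →. ℕ) : OracleCode → ℕ →. ℕ
  | zero => fun _ => 0
  | succ => Nat.succ
  | left => fun n => (Nat.unpair n).1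
  | right => fun n => (Nat.unpair n).2
  | oracle => g
  | pair c d => fun n => Nat.pair <$> eval g c n <*> eval g d n
  | comp c d => fun n => eval g d n >>= eval g c
  | prec c d => fun p =>
      let (a, n) := Nat.unpair p
      n.rec (eval g c a) fun y IH => do
        let i ← IH
        eval g d (Nat.pair a (Nat.pair y i))
  | rfind c => fun a => Nat.rfind fun n => (fun m => m = 0) <$> eval g c (Nat.pair a n)

theorem exists_eval_eq {g f : ℕ →. ℕ} (h : Nat.RecursiveIn {g} f) :
    ∃ c : OracleCode, c.eval g = f := by
  induction h with
  | zero => exact ⟨zero, rfl⟩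
  | succ => exact ⟨succ, rfl⟩
  | left => exact ⟨left, rfl⟩
  | right => exact ⟨right, rfl⟩
  | oracle g' hg => exact ⟨oracle, (Set.mem_singleton_iff.1 hg).symm⟩
  | pair _ _ ih₁ ih₂ =>
    obtain ⟨c, rfl⟩ := ih₁
    obtain ⟨d, rfl⟩ := ih₂
    exact ⟨pair c d, rfl⟩
  | comp _ _ ih₁ ih₂ =>
    obtain ⟨c, rfl⟩ := ih₁
    obtain ⟨d, rfl⟩ := ih₂
    exact ⟨comp c d, rfl⟩
  | prec _ _ ih₁ ih₂ =>
    obtain ⟨c, rfl⟩ := ih₁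
    obtain ⟨d, rfl⟩ := ih₂
    exact ⟨prec c d, rfl⟩
  | rfind _ ih =>
    obtain ⟨c, rfl⟩ := ih
    exact ⟨rfind c, rfl⟩

end OracleCode

/-- A property of sets of naturals is open if it only depends on a finite part of the set
whenever it holds. -/
def IsOpenProp (P : Set ℕ → Prop) : Prop :=
  ∀ S, P S → ∃ k, ∀ S', (∀ i < k, i ∈ S' ↔ i ∈ S) → P S'

namespace IsOpenProp

theorem const (p : Prop) : IsOpenProp fun _ => p :=
  fun _ h => ⟨0, fun _ _ => h⟩

theorem and {P Q : Set ℕ → Prop} (hP : IsOpenProp P) (hQ : IsOpenProp Q) :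
    IsOpenProp fun S => P S ∧ Q S := by
  rintro S ⟨h₁, h₂⟩
  obtain ⟨k, hk⟩ := hP S h₁
  obtain ⟨l, hl⟩ := hQ S h₂
  exact ⟨max k l, fun S' h => ⟨hk S' fun i hi => h i (lt_max_of_lt_left hi),
    hl S' fun i hi => h i (lt_max_of_lt_right hi)⟩⟩

theorem exists' {α : Sort*} {P : α → Set ℕ → Prop} (hP : ∀ a, IsOpenProp (P a)) :
    IsOpenProp fun S => ∃ a, P a S := by
  rintro S ⟨a, h⟩
  obtain ⟨k, hk⟩ := hP a S h
  exact ⟨k, fun S' h => ⟨a, hk S' h⟩⟩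

theorem forall_lt {P : ℕ → Set ℕ → Prop} (hP : ∀ n, IsOpenProp (P n)) (n : ℕ) :
    IsOpenProp fun S => ∀ m < n, P m S := by
  induction n with
  | zero => simpa using const True
  | succ n ih =>
    have := ih.and (hP n)
    simpa only [Nat.forall_lt_succ_right] using this

theorem union_left {P : Set ℕ → Prop} (hP : IsOpenProp P) (σ : Set ℕ) :
    IsOpenProp fun S => P (σ ∪ S) := by
  intro S h
  obtain ⟨k, hk⟩ := hP _ h
  exact ⟨k, fun S' h => hk _ fun i hi => by simp [h i hi]⟩

end IsOpenProp

/-- The use principle: a halting computation consults only finitely much of its oracle. -/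
theorem OracleCode.isOpenProp_mem_eval (c : OracleCode) (n m : ℕ) :
    IsOpenProp fun S => m ∈ c.eval (charFun S) n := by
  induction c generalizing n m with
  | zero | succ | left | right => exact fun _ h => ⟨0, fun _ _ => h⟩
  | oracle =>
    intro S h
    refine ⟨n + 1, fun S' hS' => ?_⟩
    have : charFun S' n = charFun S n := by
      by_cases hn : n ∈ S <;> simp [charFun, hS' n n.lt_succ_self, hn]
    exact this.symm.subst (motive := fun p => m ∈ p) h
  | pair c d ihc ihd =>
    have : (fun S => m ∈ (pair c d).eval (charFun S) n) = fun S =>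
        ∃ a b, (a ∈ c.eval (charFun S) n ∧ b ∈ d.eval (charFun S) n) ∧ Nat.pair a b = m := by
      funext S
      simp [OracleCode.eval, Seq.seq, and_assoc]
    rw [this]
    exact .exists' fun a => .exists' fun b => ((ihc _ _).and (ihd _ _)).and (.const _)
  | comp c d ihc ihd =>
    have : (fun S => m ∈ (comp c d).eval (charFun S) n) = fun S =>
        ∃ a, a ∈ d.eval (charFun S) n ∧ m ∈ c.eval (charFun S) a := by
      funext S
      exact propext Part.mem_bind_iff
    rw [this]
    exact .exists' fun a => (ihd _ _).and (ihc _ _)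
  | prec c d ihc ihd =>
    obtain ⟨⟨a, n⟩, rfl⟩ : ∃ p : ℕ × ℕ, n = Nat.pair p.1 p.2 := ⟨n.unpair, by simp⟩
    induction n generalizing m with
    | zero => simpa [OracleCode.eval] using ihc a m
    | succ n ih =>
      have : (fun S => m ∈ (prec c d).eval (charFun S) (Nat.pair a (n + 1))) = fun S =>
          ∃ i, i ∈ (prec c d).eval (charFun S) (Nat.pair a n) ∧
            m ∈ d.eval (charFun S) (Nat.pair a (Nat.pair n i)) := by
        funext S
        simp [OracleCode.eval]
      simp only [this]
      exact .exists' fun i => (ih i).and (ihd _ _)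
  | rfind c ih =>
    have : (fun S => m ∈ (rfind c).eval (charFun S) n) = fun S =>
        (∃ a, a ∈ c.eval (charFun S) (Nat.pair n m) ∧ a = 0) ∧
          ∀ k < m, ∃ a, a ∈ c.eval (charFun S) (Nat.pair n k) ∧ a ≠ 0 := by
      funext S
      refine propext (Nat.mem_rfind.trans ?_)
      simp
    rw [this]
    exact (IsOpenProp.exists' fun a => (ih _ _).and (.const _)).and
      (.forall_lt (fun k => .exists' fun a => (ih _ _).and (.const _)) m)

/-! ### Fusion and the Ramsey property of open sets -/

/-- Fusion: an infinite set can be built by choosing its elements in increasing order,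
shrinking an infinite reservoir for the later elements at every step. -/
theorem exists_infinite_of_fusion {I : Finset ℕ → Set ℕ → Prop}
    {Q : Finset ℕ → ℕ → Set ℕ → Prop} {X₀ : Set ℕ} (hX₀ : X₀.Infinite) (h₀ : I ∅ X₀)
    (step : ∀ F X, I F X → X.Infinite → X ⊆ X₀ → ∃ x ∈ X, ∃ X' ⊆ X, X'.Infinite ∧
      (∀ y ∈ X', x < y) ∧ Q F x X' ∧ I (insert x F) X') :
    ∃ B ⊆ X₀, B.Infinite ∧ ∀ x ∈ B, ∃ (F : Finset ℕ) (X' : Set ℕ),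
      (F : Set ℕ) = B ∩ Set.Iio x ∧ B ∩ Set.Ioi x ⊆ X' ∧ Q F x X' := by
  classical
  let State := {p : Finset ℕ × Set ℕ // I p.1 p.2 ∧ p.2.Infinite ∧ p.2 ⊆ X₀}
  have step' : ∀ p : State, ∃ x ∈ p.1.2, ∃ q : State, q.1.2 ⊆ p.1.2 ∧
      (∀ y ∈ q.1.2, x < y) ∧ Q p.1.1 x q.1.2 ∧ q.1.1 = insert x p.1.1 := by
    rintro ⟨⟨F, X⟩, hI, hX, hX₀'⟩
    obtain ⟨x, hx, X', hX', hinf, hlt, hQ, hI'⟩ := step F X hI hX hX₀'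
    exact ⟨x, hx, ⟨(insert x F, X'), hI', hinf, hX'.trans hX₀'⟩, hX', hlt, hQ, rfl⟩
  choose e he next hsub hlt hQ hF using step'
  let s : ℕ → State := fun n => Nat.rec ⟨(∅, X₀), h₀, hX₀, subset_rfl⟩ (fun _ p => next p) n
  have hs : ∀ n, s (n + 1) = next (s n) := fun _ => rfl
  let b : ℕ → ℕ := fun n => e (s n)
  have hanti : Antitone fun n => (s n).1.2 := antitone_nat_of_succ_le fun n => hsub (s n)
  have hmem : ∀ m n, m < n → b n ∈ (s (m + 1)).1.2 := fun m n h => hanti h (he (s n))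
  have hmono : StrictMono b :=
    strictMono_nat_of_lt_succ fun n => hlt (s n) _ (hmem n (n + 1) n.lt_succ_self)
  have hfin : ∀ n, (s n).1.1 = (Finset.range n).image b := by
    intro n
    induction n with
    | zero => rfl
    | succ n ih => rw [hs, hF, ih, Finset.range_add_one, Finset.image_insert]
  refine ⟨Set.range b, ?_, Set.infinite_range_of_injective hmono.injective, ?_⟩
  · rintro _ ⟨n, rfl⟩
    exact (s n).2.2.2 (he (s n))
  · rintro _ ⟨n, rfl⟩
    refine ⟨(s n).1.1, (s (n + 1)).1.2, ?_, ?_, hQ (s n)⟩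
    · rw [hfin]
      ext y
      simp only [Finset.coe_image, Finset.coe_range, Set.mem_image, Set.mem_Iio, Set.mem_inter_iff,
        Set.mem_range]
      constructor
      · rintro ⟨m, hm, rfl⟩
        exact ⟨⟨m, rfl⟩, hmono hm⟩
      · rintro ⟨⟨m, rfl⟩, hm⟩
        exact ⟨m, hmono.lt_iff_lt.1 hm, rfl⟩
    · rintro _ ⟨⟨m, rfl⟩, hm⟩
      exact hmem n m (hmono.lt_iff_lt.1 hm)

/-- All infinite subsets of `X`, when added to `s`, satisfy `P`. -/
def Accepts (P : Set ℕ → Prop) (X s : Set ℕ) : Prop :=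
  ∀ Y ⊆ X, Y.Infinite → P (s ∪ Y)

/-- No infinite subset of `X` accepts `s`. -/
def Rejects (P : Set ℕ → Prop) (X s : Set ℕ) : Prop :=
  ∀ Y ⊆ X, Y.Infinite → ¬ Accepts P Y s

theorem Rejects.mono {P : Set ℕ → Prop} {X X' s : Set ℕ} (h : Rejects P X s) (hX : X' ⊆ X) :
    Rejects P X' s :=
  fun Y hY => h Y (hY.trans hX)

theorem Set.Infinite.inter_Ioi_nat {X : Set ℕ} (hX : X.Infinite) (x : ℕ) :
    (X ∩ Set.Ioi x).Infinite := by
  have : X ∩ Set.Ioi x = X \ Set.Iic x := by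
    ext y
    simp
  rw [this]
  exact hX.sdiff (Set.finite_Iic x)

/-- Otherwise fusion gives `B` in which each `x` has some `s ∈ 𝒮` such that the part of `B` beyond
`x` accepts `insert x s`. One `s` serves infinitely many `x`, and these `x` form a set accepting
`s`. -/
theorem exists_rejects_insert {P : Set ℕ → Prop} {X : Set ℕ} (hX : X.Infinite)
    {𝒮 : Set (Set ℕ)} (h𝒮 : 𝒮.Finite) (h : ∀ s ∈ 𝒮, Rejects P X s) :
    ∃ x ∈ X, ∃ X' ⊆ X, X'.Infinite ∧ (∀ y ∈ X', x < y) ∧ ∀ s ∈ 𝒮, Rejects P X' (insert x s) := by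
  by_contra! hcon
  obtain ⟨B, hBX, hB, hBQ⟩ := exists_infinite_of_fusion (I := fun _ _ => True)
    (Q := fun _ x X' => ∃ s ∈ 𝒮, Accepts P X' (insert x s)) hX trivial (by
      intro F Z _ hZ hZX
      obtain ⟨x, hx⟩ := hZ.nonempty
      obtain ⟨s, hs, hr⟩ := hcon x (hZX hx) (Z ∩ Set.Ioi x) (Set.inter_subset_left.trans hZX)
        (hZ.inter_Ioi_nat x) fun y hy => hy.2
      simp only [Rejects, not_forall, not_not] at hr
      obtain ⟨Y, hYZ, hY, hacc⟩ := hr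
      exact ⟨x, hx, Y, hYZ.trans Set.inter_subset_left, hY, fun y hy => (hYZ hy).2,
        ⟨s, hs, hacc⟩, trivial⟩)
  have hBs : ∀ x ∈ B, ∃ s ∈ 𝒮, Accepts P (B ∩ Set.Ioi x) (insert x s) := by
    intro x hx
    obtain ⟨-, X', -, hX', s, hs, hacc⟩ := hBQ x hx
    exact ⟨s, hs, fun Y hY => hacc Y (hY.trans hX')⟩
  choose! f hf𝒮 hf using hBs
  obtain ⟨s, hs, hinf⟩ : ∃ s ∈ 𝒮, (B ∩ f ⁻¹' {s}).Infinite := by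
    by_contra! hfin
    refine hB ((h𝒮.biUnion hfin).subset fun x hx => ?_)
    exact Set.mem_biUnion (hf𝒮 x hx) ⟨hx, rfl⟩
  refine h s hs (B ∩ f ⁻¹' {s}) (Set.inter_subset_left.trans hBX) hinf fun Y hY hYinf => ?_
  classical
  have hne : ∃ y, y ∈ Y := hYinf.nonempty
  have hx := hY (Nat.find_spec hne)
  set x := Nat.find hne
  -- Splitting off the least element of `Y` reduces acceptance of `s` to that of `insert x s`.
  have hYx : s ∪ Y = insert x s ∪ (Y ∩ Set.Ioi x) := by
    ext y
    have h₁ : y ∈ Y → x ≤ y := fun hy => Nat.find_min' hne hy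
    have h₂ : x ∈ Y := Nat.find_spec hne
    simp only [Set.mem_union, Set.mem_insert_iff, Set.mem_inter_iff, Set.mem_Ioi]
    constructor
    · rintro (hy | hy)
      · exact .inl (.inr hy)
      · rcases (h₁ hy).eq_or_lt with h | h
        · exact .inl (.inl h.symm)
        · exact .inr ⟨hy, h⟩
    · rintro ((rfl | hy) | hy)
      · exact .inr h₂
      · exact .inl hy
      · exact .inr hy.1
  have hacc := hf x hx.1
  rw [show f x = s from hx.2] at hacc
  rw [hYx]
  exact hacc _ (Set.inter_subset_inter_left _ fun y hy => (hY hy).1) (hYinf.inter_Ioi_nat x)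

/-- The Ramsey property of open sets. -/
theorem IsOpenProp.exists_homogeneous {P : Set ℕ → Prop} (hP : IsOpenProp P) {X : Set ℕ}
    (hX : X.Infinite) : ∃ X' ⊆ X, X'.Infinite ∧
      ((∀ S ⊆ X', S.Infinite → P S) ∨ ∀ S ⊆ X', S.Infinite → ¬ P S) := by
  by_cases hr : Rejects P X ∅
  · obtain ⟨B, hBX, hB, hBQ⟩ := exists_infinite_of_fusion
      (I := fun F X => ∀ s : Set ℕ, s ⊆ F → Rejects P X s)
      (Q := fun F x X' => ∀ s : Set ℕ, s ⊆ insert x F → Rejects P X' s) hX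
      (by
        intro s hs
        rw [Finset.coe_empty, Set.subset_empty_iff] at hs
        rwa [hs]) (by
        intro F Z hI hZ hZX
        obtain ⟨x, hx, X', hX', hinf, hlt, hrej⟩ := exists_rejects_insert hZ
          (F.finite_toSet.powerset) hI
        have key : ∀ s : Set ℕ, s ⊆ insert x F → Rejects P X' s := by
          intro s hs
          by_cases hxs : x ∈ s
          · have := hrej (s \ {x}) (by simpa [Set.sdiff_subset_iff] using hs)
            rwa [Set.insert_sdiff_singleton, Set.insert_eq_of_mem hxs] at this
          · exact (hI s ((Set.subset_insert_iff_of_notMem hxs).1 hs)).mono hX'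
        exact ⟨x, hx, X', hX', hinf, hlt, key, by simpa only [Finset.coe_insert] using key⟩)
    refine ⟨B, hBX, hB, .inr fun S hS hSinf hPS => ?_⟩
    obtain ⟨k, hk⟩ := hP S hPS
    obtain ⟨x, hxS, hkx⟩ := hSinf.exists_gt k
    obtain ⟨F, X', hF, hX', hQ⟩ := hBQ x (hS hxS)
    -- As `k < x`, the part of `S` up to `x` already decides `P`, so the tail of `S` would accept
    -- it.
    refine hQ (S ∩ Set.Iic x) ?_ (S ∩ Set.Ioi x)
      ((Set.inter_subset_inter_left _ hS).trans hX') (hSinf.inter_Ioi_nat x) ?_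
    · rintro y ⟨hy, hyx⟩
      rcases (Set.mem_Iic.1 hyx).eq_or_lt with rfl | h
      · exact Set.mem_insert _ _
      · exact Set.mem_insert_of_mem _ (hF ▸ ⟨hS hy, h⟩)
    · intro Y hY _
      refine hk _ fun i hi => ?_
      constructor
      · rintro (h | h)
        · exact h.1
        · exact (hY h).1
      · exact fun h => .inl ⟨h, (hi.trans hkx).le⟩
  · simp only [Rejects, not_forall, not_not] at hr
    obtain ⟨Y, hY, hYinf, hacc⟩ := hr
    exact ⟨Y, hY, hYinf, .inl fun S hS hSinf => by simpa using hacc S hS hSinf⟩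

theorem exists_homogeneous_of_finite {ι : Type*} (J : Finset ι) {P : ι → Set ℕ → Prop}
    (hP : ∀ i, IsOpenProp (P i)) {X : Set ℕ} (hX : X.Infinite) :
    ∃ X' ⊆ X, X'.Infinite ∧ ∀ i ∈ J,
      (∀ S ⊆ X', S.Infinite → P i S) ∨ ∀ S ⊆ X', S.Infinite → ¬ P i S := by
  classical
  induction J using Finset.induction_on with
  | empty => exact ⟨X, subset_rfl, hX, by simp⟩
  | insert i J _ ih =>
    obtain ⟨Y, hYX, hY, hhom⟩ := ih
    obtain ⟨Z, hZY, hZ, hhom'⟩ := (hP i).exists_homogeneous hY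
    refine ⟨Z, hZY.trans hYX, hZ, fun j hj => ?_⟩
    rcases Finset.mem_insert.1 hj with rfl | hj
    · exact hhom'
    · exact (hhom j hj).imp (fun h S hS => h S (hS.trans hZY)) fun h S hS => h S (hS.trans hZY)

/-! ### Diagonalisation against countably many open relations -/

/-- Among infinitely many naturals there are two which finitely many open properties cannot
distinguish on a suitable reservoir. -/
theorem exists_lt_indistinguishable {ι : Type*} (J : Finset ι) {P : ι → ℕ → Set ℕ → Prop}
    (hP : ∀ i t, IsOpenProp (P i t)) {X : Set ℕ} (hX : X.Infinite) :
    ∃ t ∈ X, ∃ x ∈ X, t < x ∧ ∃ X' ⊆ X, X'.Infinite ∧ (∀ y ∈ X', x < y) ∧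
      ∀ i ∈ J, ∀ S ⊆ X', S.Infinite → P i x S → P i t S := by
  classical
  -- One more point than there are subsets of `J`: two points share the set of properties that hold
  -- throughout `Y`.
  obtain ⟨T, hTX, hT⟩ := hX.exists_subset_card_eq (J.powerset.card + 1)
  obtain ⟨Y, hYX, hY, hhom⟩ := exists_homogeneous_of_finite (J ×ˢ T)
    (P := fun p => P p.1 p.2) (fun p => hP p.1 p.2) hX
  obtain ⟨t, ht, x, hx, hne, heq⟩ := Finset.exists_ne_map_eq_of_card_lt_of_maps_to
    (s := T) (t := J.powerset) (by omega)
    (f := fun t => J.filter fun i => ∀ S ⊆ Y, S.Infinite → P i t S)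
    (fun t _ => Finset.mem_coe.2 (Finset.mem_powerset.2 (Finset.filter_subset _ _)))
  have key : ∀ t ∈ T, ∀ x ∈ T, t < x →
      (J.filter fun i => ∀ S ⊆ Y, S.Infinite → P i t S) =
        (J.filter fun i => ∀ S ⊆ Y, S.Infinite → P i x S) →
      ∃ t ∈ X, ∃ x ∈ X, t < x ∧ ∃ X' ⊆ X, X'.Infinite ∧ (∀ y ∈ X', x < y) ∧
        ∀ i ∈ J, ∀ S ⊆ X', S.Infinite → P i x S → P i t S := by
    intro t ht x hx hlt heq
    refine ⟨t, hTX ht, x, hTX hx, hlt, Y ∩ Set.Ioi x, Set.inter_subset_left.trans hYX,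
      hY.inter_Ioi_nat x, fun y hy => hy.2, fun i hi S hS hSinf hPx => ?_⟩
    have hSY : S ⊆ Y := hS.trans Set.inter_subset_left
    have hmem : i ∈ J.filter fun i => ∀ S ⊆ Y, S.Infinite → P i x S := by
      refine Finset.mem_filter.2 ⟨hi, ?_⟩
      exact (hhom (i, x) (Finset.mk_mem_product hi hx)).resolve_right
        fun h => h S hSY hSinf hPx
    rw [← heq] at hmem
    exact (Finset.mem_filter.1 hmem).2 S hSY hSinf
  rcases hne.lt_or_gt with h | h
  · exact key t ht x hx h heq
  · exact key x hx t ht h heq.symm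

/-- Given countably many open relations, every infinite set has an infinite subset `B` such that
none of them relates exactly the elements of `C` to `S`, for any `C, S ⊆ B` with `S` and `C \ S`
infinite. -/
theorem exists_subset_forall_ne {U : ℕ → ℕ → Set ℕ → Prop} (hU : ∀ e t, IsOpenProp (U e t))
    {A : Set ℕ} (hA : A.Infinite) :
    ∃ B ⊆ A, B.Infinite ∧ ∀ S ⊆ B, S.Infinite → ∀ C ⊆ B, (C \ S).Infinite →
      ∀ e, {t | U e t S} ≠ C := by
  classical
  obtain ⟨B, hBA, hB, hBQ⟩ := exists_infinite_of_fusion (I := fun _ _ => True)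
    -- Since `t < x` and `t ∉ F`, `t` never enters `B`. Bounding `e` by an element of `F` keeps each
    -- step finite, yet every `e` is eventually covered.
    (Q := fun F x X' => ∃ t < x, t ∉ F ∧ ∀ f ∈ F, ∀ e ≤ f, ∀ σ ⊆ F, ∀ S ⊆ X', S.Infinite →
      U e x (σ ∪ S) → U e t (σ ∪ S)) hA trivial (by
      intro F X _ hX _
      obtain ⟨t, ht, x, hx, hlt, X', hX', hinf, hX'x, hind⟩ := exists_lt_indistinguishable
        ((Finset.range (F.sup id + 1)) ×ˢ F.powerset)
        (P := fun p t S => U p.1 t (p.2 ∪ S)) (fun p t => (hU p.1 t).union_left p.2)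
        (hX.sdiff F.finite_toSet)
      refine ⟨x, hx.1, X', hX'.trans Set.sdiff_subset, hinf, hX'x, ⟨t, hlt, ht.2, ?_⟩, trivial⟩
      intro f hf e he σ hσ
      refine hind (e, σ) (Finset.mk_mem_product ?_ (Finset.mem_powerset.2 hσ))
      exact Finset.mem_range.2 (Nat.lt_succ_of_le (he.trans (Finset.le_sup (f := id) hf))))
  refine ⟨B, hBA, hB, fun S hS hSinf C hC hCS e hUC => ?_⟩
  obtain ⟨f, hfB, hef⟩ := hB.exists_gt e
  obtain ⟨x, ⟨hxC, hxS⟩, hfx⟩ := hCS.exists_gt f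
  obtain ⟨F, X', hF, hX', t, htx, htF, hind⟩ := hBQ x (hC hxC)
  have hF' : ∀ y, y ∈ F ↔ y ∈ B ∧ y < x := fun y => by
    rw [← Finset.mem_coe, hF]
    rfl
  -- This needs `x ∉ S`, which is why `C \ S` has to be infinite.
  have hS' : ((F.filter (· ∈ S) : Finset ℕ) : Set ℕ) ∪ (S ∩ Set.Ioi x) = S := by
    ext y
    simp only [Finset.coe_filter, hF', Set.mem_union, Set.mem_ofPred_eq, Set.mem_inter_iff,
      Set.mem_Ioi]
    constructor
    · rintro (h | h)
      · exact h.2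
      · exact h.1
    · intro hy
      rcases lt_trichotomy y x with h | rfl | h
      · exact .inl ⟨⟨hS hy, h⟩, hy⟩
      · exact absurd hy hxS
      · exact .inr ⟨hy, h⟩
  have hUx : U e x S := by
    rw [← hUC] at hxC
    exact hxC
  have hUt := hind f ((hF' f).2 ⟨hfB, hfx⟩) e hef.le (F.filter (· ∈ S)) (Finset.filter_subset _ _)
    (S ∩ Set.Ioi x) ((Set.inter_subset_inter_left _ hS).trans hX') (hSinf.inter_Ioi_nat x)
  rw [hS'] at hUt
  have htC : t ∈ C := hUC ▸ hUt hUx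
  exact htF ((hF' t).2 ⟨hC htC, htx⟩)

/-- If `C \ D` is finite, every other element of `C ∩ D` will do. -/
theorem Set.Infinite.exists_subset_diff_infinite {C D : Set ℕ} (hC : C.Infinite)
    (hD : D.Infinite) : ∃ S ⊆ D, S.Infinite ∧ (C \ S).Infinite := by
  by_cases h : (C \ D).Infinite
  · exact ⟨D, subset_rfl, hD, h⟩
  have hCD : (C ∩ D).Infinite := fun hfin =>
    hC (Set.inter_union_sdiff C D ▸ hfin.union (Set.not_infinite.1 h))
  have hinj := Nat.nth_injective hCD
  refine ⟨Set.range fun n => Nat.nth (· ∈ C ∩ D) (2 * n), ?_, ?_, ?_⟩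
  · rintro _ ⟨n, rfl⟩
    exact (Nat.nth_mem_of_infinite hCD _).2
  · exact Set.infinite_range_of_injective fun m n hmn => by
      have := hinj hmn
      omega
  · refine (Set.infinite_range_of_injective (f := fun n => Nat.nth (· ∈ C ∩ D) (2 * n + 1))
      fun m n hmn => ?_).mono ?_
    · have := hinj hmn
      omega
    · rintro _ ⟨n, rfl⟩
      refine ⟨(Nat.nth_mem_of_infinite hCD _).1, ?_⟩
      rintro ⟨m, hm⟩
      have := hinj hm
      omega

/-- Only output 1 is recorded, because this is an open condition on the oracle. -/
theorem SetComputes.exists_code {S C : Set ℕ} (h : SetComputes S C) :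
    ∃ c : OracleCode, {t | 1 ∈ c.eval (charFun S) t} = C := by
  obtain ⟨c, hc⟩ := OracleCode.exists_eval_eq (RecursiveIn.iff_nat.1 h)
  refine ⟨c, ?_⟩
  ext t
  by_cases ht : t ∈ C <;> simp [hc, charFun, ht]

theorem mainTheorem9 (A : Set ℕ) (hA : A.Infinite) :
    ∃ B : Set ℕ, B ⊆ A ∧ B.Infinite ∧
      (∀ C D : Set ℕ, C ⊆ B → C.Infinite → D ⊆ B → D.Infinite → ¬ Introcomputable C D) ∧
      (∀ C : Set ℕ, C ⊆ B → ¬ Introreducible C) := by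
  have : Nonempty OracleCode := ⟨.zero⟩
  obtain ⟨code, hcode⟩ := exists_surjective_nat OracleCode
  obtain ⟨B, hBA, hB, hne⟩ := exists_subset_forall_ne
    (U := fun e t S => 1 ∈ (code e).eval (charFun S) t)
    (fun e t => (code e).isOpenProp_mem_eval t 1) hA
  have key : ∀ C D : Set ℕ, C ⊆ B → C.Infinite → D ⊆ B → D.Infinite → ¬ Introcomputable C D := by
    intro C D hC hCinf hD hDinf h
    obtain ⟨S, hSD, hS, hCS⟩ := hCinf.exists_subset_diff_infinite hDinf
    obtain ⟨c, hc⟩ := (h S hSD hS).exists_code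
    obtain ⟨e, rfl⟩ := hcode c
    exact hne S (hSD.trans hD) hS C hC hCS e hc
  exact ⟨B, hBA, hB, key, fun C hC h => key C C hC h.1 hC h.1 h.2⟩
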